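/- Write $[\mathbb N]^\infty$ for the family of all infinite subsets of $\mathbb N$ and $\mathrm{Fin}$ for the family of all finite subsets of $\mathbb N$. Identify $P(\mathbb N)$ with the Cantor space $\{0,1\}^{\mathbb N}$ via characteristic functions, and each $a\in[\mathbb N]^\infty$ with its increasing enumeration $n\mapsto a(n)$. A set of reals is a topological space homeomorphic to a subspace of $\mathbb R$. Let $\mathfrak p$ be the minimal cardinality of a family $F\subseteq[\mathbb N]^\infty$ such that all intersections of finitely many members of $F$ are infinite, but there is no infinite set $a\subseteq\mathbb N$ with $a\setminus b$ finite for all $b\in F$. A set $X\subseteq[\mathbb N]^\infty$ with $|X|\ge\mathfrak p$ is a $\mathfrak p$-generalized tower if for each $a\in[\mathbb N]^\infty$ there are $b\in[\mathbb N]^\infty$ and $S\subseteq X$ with $|S|<\mathfrak p$ such that $x\cap\bigcup_{n\in b}[a(n),a(n+1))$ is finite for all $x\in X\setminus S$. The corresponding $\mathfrak p$-generalized tower set is the subspace $X\cup\mathrm{Fin}$ of $P(\mathbb N)$. An open cover of a space is a family of open proper subsets of the space whose union is the whole space. It is an $\omega$-cover if each finite subset of the space is contained in a member of the cover. It is a $\gamma$-cover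 if it is infinite and each point of the space belongs to all but finitely many of its members. A space satisfies $\binom{\Omega}{\Gamma}$ (property $\gamma$) if every $\omega$-cover of the space contains a $\gamma$-cover of the space. A space satisfies $\mathsf S_1(\Gamma,\Gamma)$ if for each sequence $\mathcal U_1,\mathcal U_2,\dots$ of open $\gamma$-covers of the space there are sets $U_1\in\mathcal U_1,U_2\in\mathcal U_2,\dots$ such that $\{U_n: n\in\mathbb N\}$ is an open $\gamma$-cover of the space. **Corollary.** Let $X$ be a $\mathfrak p$-generalized tower and let $Y$ be a set of reals satisfying $\binom{\Omega}{\Gamma}$. Then for every natural number $k$, the power $\bigl((X\cup\mathrm{Fin})\times Y\bigr)^k$ satisfies $\mathsf S_1(\Gamma,\Gamma)$. -/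

import Mathlib

namespace GenTower

open Set
open scoped Cardinal

section Covers

variable {X : Type*}

/-- A cover of `X`: a family of proper subsets of `X` whose union is `X`. -/
def IsCover (𝒰 : Set (Set X)) : Prop :=
  (∀ U ∈ 𝒰, U ≠ univ) ∧ ⋃₀ 𝒰 = univ

/-- An open cover of a space: a cover whose members are open. -/
def IsOpenCover [TopologicalSpace X] (𝒰 : Set (Set X)) : Prop :=
  IsCover 𝒰 ∧ ∀ U ∈ 𝒰, IsOpen U

variable (X) in
/-- `Γ(X)`: the open `γ`-covers of `X`, i.e. the infinite open covers such that each point belongs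
to all but finitely many members. -/
def Gam [TopologicalSpace X] : Set (Set (Set X)) :=
  {𝒰 | IsOpenCover 𝒰 ∧ 𝒰.Infinite ∧ ∀ x : X, {U ∈ 𝒰 | x ∉ U}.Finite}

variable (X) in
/-- `Ω(X)`: the `ω`-covers of `X`, i.e. the open covers such that each finite subset of `X` is
contained in a member. -/
def Om [TopologicalSpace X] : Set (Set (Set X)) :=
  {𝒰 | IsOpenCover 𝒰 ∧ ∀ F : Set X, F.Finite → ∃ U ∈ 𝒰, F ⊆ U}

/-- The selection principle `S₁(𝒜, ℬ)` for families `𝒜`, `ℬ` of covers of `X`. -/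
def S1 (𝒜 ℬ : Set (Set (Set X))) : Prop :=
  ∀ 𝒰 : ℕ → Set (Set X), (∀ n, 𝒰 n ∈ 𝒜) →
    ∃ U : ℕ → Set X, (∀ n, U n ∈ 𝒰 n) ∧ range U ∈ ℬ

variable (X) in
/-- The property `S₁(Γ, Γ)` of a space. -/
def S1GammaGamma [TopologicalSpace X] : Prop :=
  S1 (Gam X) (Gam X)

variable (X) in
/-- The property `γ`: every `ω`-cover of the space contains a `γ`-cover of the space. -/
def GammaProperty [TopologicalSpace X] : Prop :=
  ∀ 𝒰 ∈ Om X, ∃ 𝒱 ⊆ 𝒰, 𝒱 ∈ Gam X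

variable (X) in
/-- A set of reals: a space homeomorphic to a subspace of the real line. -/
def IsSetOfReals [TopologicalSpace X] : Prop :=
  ∃ f : X → ℝ, Topology.IsEmbedding f

end Covers

/-- `a ⊆* b`: the set `a \ b` is finite. -/
def AlmostSubset (a b : Set ℕ) : Prop := (a \ b).Finite

/-- A family of sets is centered if the intersections of its finite subfamilies are infinite. -/
def Centered (F : Set (Set ℕ)) : Prop :=
  ∀ G ⊆ F, G.Finite → (⋂₀ G).Infinite

/-- A pseudointersection of a family: an infinite set that is almost contained in every member. -/
def IsPseudointersection (a : Set ℕ) (F : Set (Set ℕ)) : Prop :=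
  a.Infinite ∧ ∀ b ∈ F, AlmostSubset a b

/-- The cardinal `𝔭`: the minimal cardinality of a centered family of infinite subsets of `ℕ` that
has no pseudointersection. -/
noncomputable def pCard : Cardinal.{0} :=
  sInf {κ | ∃ F : Set (Set ℕ), (∀ b ∈ F, b.Infinite) ∧ Centered F ∧
    (¬ ∃ a, IsPseudointersection a F) ∧ #F = κ}

/-- The increasing enumeration of an infinite set `a ⊆ ℕ`. -/
noncomputable def enum (a : Set ℕ) (n : ℕ) : ℕ := Nat.nth (· ∈ a) n

/-- `κ`-generalized towers of infinite subsets of `ℕ`. -/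
def IsGeneralizedTower (κ : Cardinal.{0}) (X : Set (Set ℕ)) : Prop :=
  (∀ x ∈ X, x.Infinite) ∧ κ ≤ #X ∧
    ∀ a : Set ℕ, a.Infinite → ∃ b : Set ℕ, b.Infinite ∧ ∃ S ⊆ X, #S < κ ∧
      ∀ x ∈ X \ S, (x ∩ ⋃ n ∈ b, Ico (enum a n) (enum a (n + 1))).Finite

/-- The set `X ∪ Fin` as a subset of the Cantor space `ℕ → Bool` (product topology), where a subset
of `ℕ` is identified with its characteristic function. If `X` is a `κ`-generalized tower, this is
the corresponding `κ`-generalized tower set. -/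
def towerSet (X : Set (Set ℕ)) : Set (ℕ → Bool) :=
  {z | {n | z n = true} ∈ X ∪ {s : Set ℕ | s.Finite}}

end GenTower

/-! Write T for `towerSet X`. `ThinSelection` implies S₁(Γ,Γ), and goodness of a set of columns
passes to almost subsets. Hence goodness on fewer than 𝔭 subspaces can be secured at once, by a
transfinite recursion with pseudointersections (`exists_subset_forall_of_dense`). The γ-property of
Y gives S₁(Ω,Γ) for Y^k (`GammaProperty.omegaSelection_pi`). This selection yields successive
intervals such that points of T^k vanishing on an interval are controlled there; the tower property
then provides columns good at every point of T^k × Y^k with no coordinate in some S, |S| < 𝔭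
(`IsGeneralizedTower.exists_good`). The other points lie in fewer than 𝔭 copies of T^(k-1) × Y^k, so
induction on the exponent of T, with Y^k fixed, finishes the proof
(`IsGeneralizedTower.thinSelection_prod`). -/

namespace GenTower

open Set Filter Topology
open scoped Cardinal

/-! ### Diagonalization below 𝔭. -/

section Pseudointersections

theorem AlmostSubset.refl (a : Set ℕ) : AlmostSubset a a := by
  simp [AlmostSubset]

theorem AlmostSubset.of_subset {a b : Set ℕ} (h : a ⊆ b) : AlmostSubset a b := by
  simp [AlmostSubset, sdiff_eq_empty.2 h]

theorem AlmostSubset.trans {a b c : Set ℕ} (hab : AlmostSubset a b) (hbc : AlmostSubset b c) :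
    AlmostSubset a c :=
  (hab.union hbc).subset fun x hx => by
    by_cases hb : x ∈ b
    · exact Or.inr ⟨hb, hx.2⟩
    · exact Or.inl ⟨hx.1, hb⟩

theorem AlmostSubset.inter_infinite {a b : Set ℕ} (hab : AlmostSubset a b) (ha : a.Infinite) :
    (a ∩ b).Infinite := fun h =>
  ha ((hab.union h).subset fun x hx => by
    by_cases hb : x ∈ b
    · exact Or.inr ⟨hx, hb⟩
    · exact Or.inl ⟨hx, hb⟩)

theorem exists_pseudointersection {F : Set (Set ℕ)} (hF : ∀ b ∈ F, b.Infinite) (hc : Centered F)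
    (hcard : #F < pCard) : ∃ a, IsPseudointersection a F := by
  by_contra h
  exact absurd (csInf_le' ⟨F, hF, hc, h, rfl⟩ : pCard ≤ #F) (not_le.2 hcard)

/-- A finite centered family has its own intersection as a pseudointersection. The hypothesis
excludes the default value `sInf ∅ = 0`. -/
theorem aleph0_le_pCard (h : pCard ≠ 0) : ℵ₀ ≤ pCard := by
  have hne : {κ : Cardinal.{0} | ∃ F : Set (Set ℕ), (∀ b ∈ F, b.Infinite) ∧ Centered F ∧
      (¬ ∃ a, IsPseudointersection a F) ∧ #F = κ}.Nonempty := by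
    rw [nonempty_iff_ne_empty]
    intro h0
    exact h (by rw [pCard, h0, Cardinal.sInf_empty])
  obtain ⟨F, -, hc, hno, hcard⟩ := csInf_mem hne
  change #F = pCard at hcard
  by_contra hlt
  rw [← hcard, not_le, Cardinal.lt_aleph0_iff_set_finite] at hlt
  exact hno ⟨⋂₀ F, hc F subset_rfl hlt, fun b hb =>
    AlmostSubset.of_subset (sInter_subset_of_mem hb)⟩

/-- An almost decreasing family of fewer than `𝔭` infinite sets has a pseudointersection. -/
theorem exists_pseudointersection_of_chain {ι : Type} [LinearOrder ι] (hι : #ι < pCard)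
    (e : ι → Set ℕ) (he : ∀ i, (e i).Infinite) (hmono : ∀ i j, i < j → AlmostSubset (e j) (e i)) :
    ∃ d : Set ℕ, d.Infinite ∧ ∀ i, AlmostSubset d (e i) := by
  have hc : Centered (range e) := by
    intro G hG hfin
    have hsub : G ⊆ e '' univ := by rwa [image_univ]
    obtain ⟨J, -, hJ, rfl⟩ : ∃ J ⊆ univ, J.Finite ∧ e '' J = G := by
      obtain ⟨J, hJ, hJf, h⟩ := exists_subset_image_finite_and (p := fun s => s = G) |>.1
        ⟨G, hsub, hfin, rfl⟩
      exact ⟨J, hJ, hJf, h⟩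
    rcases J.eq_empty_or_nonempty with rfl | hne
    · simpa using infinite_univ
    obtain ⟨j, hj, hmax⟩ := hJ.exists_maximal hne
    have hjm : ∀ i ∈ J, AlmostSubset (e j) (e i) := fun i hi => by
      rcases lt_trichotomy i j with h | rfl | h
      · exact hmono _ _ h
      · exact AlmostSubset.refl _
      · exact absurd (hmax hi h.le) (not_le.2 h)
    have hA : AlmostSubset (e j) (⋂₀ (e '' J)) := by
      refine (hJ.biUnion hjm).subset fun x hx => ?_
      simp only [Set.mem_sdiff, mem_sInter, forall_mem_image, not_forall] at hx
      obtain ⟨hx, i, hi, hxi⟩ := hx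
      exact mem_biUnion hi ⟨hx, hxi⟩
    exact (hA.inter_infinite (he j)).mono inter_subset_right
  obtain ⟨d, hd, hde⟩ := exists_pseudointersection (by rintro _ ⟨i, rfl⟩; exact he i) hc
    (Cardinal.mk_range_le.trans_lt hι)
  exact ⟨d, hd, fun i => hde _ ⟨i, rfl⟩⟩

/-- Fewer than `𝔭` properties of infinite sets that are dense and inherited by almost subsets
have a common witness below every infinite set. -/
theorem exists_subset_forall_of_dense {ι : Type} (hι : #ι < pCard) (D : ι → Set ℕ → Prop)
    (hD : ∀ i c d, AlmostSubset d c → D i c → D i d)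
    (hdense : ∀ i a, a.Infinite → ∃ c ⊆ a, c.Infinite ∧ D i c) {a : Set ℕ} (ha : a.Infinite) :
    ∃ c ⊆ a, c.Infinite ∧ ∀ i, D i c := by
  classical
  obtain ⟨r, hr⟩ : ∃ r : LinearOrder ι, WellFoundedLT ι :=
    ⟨linearOrderOfSTO WellOrderingRel, ⟨WellOrderingRel.isWellOrder.wf⟩⟩
  have hp : ℵ₀ ≤ pCard := aleph0_le_pCard (ne_bot_of_gt hι)
  have hopt : ∀ κ : Type, #κ ≤ #ι → #(WithBot κ) < pCard := fun κ hκ => by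
    change #(Option κ) < pCard
    rw [Cardinal.mk_option]
    exact Cardinal.add_lt_of_lt hp (hκ.trans_lt hι) (Cardinal.one_lt_aleph0.trans_le hp)
  have hwf : WellFounded ((· < ·) : ι → ι → Prop) := hr.wf
  let P : (i : ι) → ((j : ι) → j < i → Set ℕ) → Set ℕ → Prop := fun i c s =>
    s ⊆ a ∧ s.Infinite ∧ D i s ∧ ∀ j (h : j < i), AlmostSubset s (c j h)
  let c : ι → Set ℕ := hwf.fix fun i c => Classical.epsilon (P i c)
  have hc : ∀ i, c i = Classical.epsilon (P i fun j _ => c j) := fun i => hwf.fix_eq _ i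
  have key : ∀ i, P i (fun j _ => c j) (c i) := by
    intro i
    induction i using hwf.induction with
    | _ i ih =>
    rw [hc i]
    apply Classical.epsilon_spec (p := P i fun j _ => c j)
    obtain ⟨d, hd, hde⟩ := exists_pseudointersection_of_chain
      (hopt (Iio i) (Cardinal.mk_set_le _))
      -- The added index `⊥` carries `a`, so the pseudointersection stays infinite when cut down to
      -- `a`.
      (fun j => WithBot.recBotCoe (C := fun _ => Set ℕ) a (fun j : Iio i => c j) j)
      (by
        intro j
        induction j using WithBot.recBotCoe with
        | bot => exact ha
        | coe j => exact (ih j j.2).2.1)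
      (by
        intro j k hjk
        induction k using WithBot.recBotCoe with
        | bot => exact absurd hjk not_lt_bot
        | coe k =>
        induction j using WithBot.recBotCoe with
        | bot => exact AlmostSubset.of_subset (ih k k.2).1
        | coe j => exact (ih k k.2).2.2.2 j (Subtype.coe_lt_coe.2 (WithBot.coe_lt_coe.1 hjk)))
    obtain ⟨s, hs, hsi, hsD⟩ := hdense i (d ∩ a) ((hde ⊥).inter_infinite hd)
    exact ⟨s, hs.trans inter_subset_right, hsi, hsD, fun j hj =>
      (AlmostSubset.of_subset (hs.trans inter_subset_left)).trans (hde ((⟨j, hj⟩ : Iio i)))⟩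
  obtain ⟨d, hd, hde⟩ := exists_pseudointersection_of_chain (hopt ι le_rfl)
      (fun j => WithBot.recBotCoe (C := fun _ => Set ℕ) a c j)
      (by
        intro j
        induction j using WithBot.recBotCoe with
        | bot => exact ha
        | coe j => exact (key j).2.1)
      (by
        intro j k hjk
        induction k using WithBot.recBotCoe with
        | bot => exact absurd hjk not_lt_bot
        | coe k =>
        induction j using WithBot.recBotCoe with
        | bot => exact AlmostSubset.of_subset (key k).1
        | coe j => exact (key k).2.2.2 j (WithBot.coe_lt_coe.1 hjk))
  exact ⟨d ∩ a, inter_subset_right, (hde ⊥).inter_infinite hd, fun i =>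
    hD i (c i) _ ((AlmostSubset.of_subset inter_subset_left).trans (hde i)) (key i).2.2.1⟩

end Pseudointersections

/-! ### Good sets of columns and S₁(Γ,Γ). -/

section Thinning

variable {Z : Type*}

/-- The point `z` belongs to `V n m` for all large `m ∈ c`, where `n` may exceed by any constant
the position of `m` in `c`. -/
def IsGoodAt (V : ℕ → ℕ → Set Z) (c : Set ℕ) (z : Z) : Prop :=
  ∀ l, ∀ᶠ m in atTop, m ∈ c → z ∈ V ((c ∩ Iio m).ncard + l) m

theorem IsGoodAt.of_almostSubset {V : ℕ → ℕ → Set Z} (hV : ∀ m, Antitone fun n => V n m)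
    {c d : Set ℕ} {z : Z} (hc : IsGoodAt V c z) (hdc : AlmostSubset d c) : IsGoodAt V d z := by
  intro l
  have hout : ∀ᶠ m in atTop, m ∉ d \ c := by
    rw [← Nat.cofinite_eq_atTop]
    exact hdc.eventually_cofinite_notMem
  -- Elements of `d \ c` raise positions by at most their number, which the free constant `l`
  -- absorbs.
  filter_upwards [hc ((d \ c).ncard + l), hout] with m hm hmo hmd
  have hmc : m ∈ c := by_contra fun h => hmo ⟨hmd, h⟩
  refine hV m ?_ (hm hmc)
  have h1 : (d ∩ Iio m).ncard ≤ ((c ∩ Iio m) ∪ (d \ c)).ncard := by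
    refine ncard_le_ncard ?_ (((finite_Iio m).inter_of_right c).union hdc)
    rintro x ⟨hx, hxm⟩
    by_cases h : x ∈ c
    · exact Or.inl ⟨h, hxm⟩
    · exact Or.inr ⟨hx, h⟩
  have h2 := ncard_union_le (c ∩ Iio m) (d \ c)
  omega

/-- A selection can be thinned out to a set witnessing goodness. -/
theorem exists_good_of_selection {V : ℕ → ℕ → Set Z} (hV : ∀ m, Antitone fun n => V n m)
    {f : ℕ → ℕ} (hf : ∀ n, n ≤ f n) : ∃ c ⊆ range f, c.Infinite ∧
      ∀ z, (∀ᶠ n in atTop, z ∈ V n (f n)) → IsGoodAt V c z := by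
  obtain ⟨φ, hφ, hφf⟩ := strictMono_subseq_of_id_le hf
  have h2 : StrictMono fun n : ℕ => 2 * n := fun a b h => by dsimp; omega
  -- Keeping every second term makes the row at least `2 * n` at position `n`, which exceeds `n + l`
  -- by any fixed `l` eventually.
  have hg : StrictMono fun n => f (φ (2 * n)) := hφf.comp h2
  refine ⟨range fun n => f (φ (2 * n)), ?_, infinite_range_of_injective hg.injective, ?_⟩
  · rintro _ ⟨n, rfl⟩
    exact ⟨_, rfl⟩
  intro z hz l
  have hz' : ∀ᶠ n in atTop, z ∈ V (φ (2 * n)) (f (φ (2 * n))) :=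
    (hφ.comp h2).tendsto_atTop.eventually hz
  obtain ⟨N, hN⟩ := eventually_atTop.1 (hz'.and (eventually_ge_atTop l))
  filter_upwards [eventually_ge_atTop (f (φ (2 * N)))] with m hm hmc
  obtain ⟨n, rfl⟩ := hmc
  have hNn : N ≤ n := hg.le_iff_le.1 hm
  obtain ⟨h1, h3⟩ := hN n hNn
  have hcount : (range (fun n => f (φ (2 * n))) ∩ Iio (f (φ (2 * n)))).ncard ≤ n := by
    have : range (fun n => f (φ (2 * n))) ∩ Iio (f (φ (2 * n))) ⊆
        (fun n => f (φ (2 * n))) '' (Iio n) := by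
      rintro _ ⟨⟨k, rfl⟩, hk⟩
      exact ⟨k, hg.lt_iff_lt.1 hk, rfl⟩
    refine (ncard_le_ncard this ((finite_Iio n).image _)).trans
      ((ncard_image_le (finite_Iio n)).trans ?_)
    simp [ncard_eq_toFinset_card']
  refine hV _ ?_ h1
  have := hφ.id_le (2 * n)
  simp only [id] at this
  exact (Nat.add_le_add hcount h3).trans (by omega)

variable (Z) in
/-- Every decreasing double sequence of open sets whose rows are point-cofinite has, below each
infinite set of columns, an infinite set of columns that is good at all points. -/
def ThinSelection [TopologicalSpace Z] : Prop :=
  ∀ V : ℕ → ℕ → Set Z, (∀ n m, IsOpen (V n m)) → (∀ m, Antitone fun n => V n m) →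
    (∀ z n, ∀ᶠ m in atTop, z ∈ V n m) → ∀ a : Set ℕ, a.Infinite →
      ∃ c ⊆ a, c.Infinite ∧ ∀ z, IsGoodAt V c z

theorem ThinSelection.exists_good_of_lt_pCard [TopologicalSpace Z] {W : Type*} [TopologicalSpace W]
    (hW : ThinSelection W) {ι : Type} (hι : #ι < pCard) (g : ι → W → Z)
    (hg : ∀ i, Continuous (g i)) {V : ℕ → ℕ → Set Z} (hVo : ∀ n m, IsOpen (V n m))
    (hV : ∀ m, Antitone fun n => V n m) (hVγ : ∀ z n, ∀ᶠ m in atTop, z ∈ V n m)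
    {a : Set ℕ} (ha : a.Infinite) :
    ∃ c ⊆ a, c.Infinite ∧ ∀ i w, IsGoodAt V c (g i w) :=
  exists_subset_forall_of_dense hι (fun i c => ∀ w, IsGoodAt V c (g i w))
    (fun _ _ _ hdc hc w => (hc w).of_almostSubset hV hdc)
    (fun i a ha => hW (fun n m => g i ⁻¹' V n m) (fun n m => (hVo n m).preimage (hg i))
      (fun m _ _ h => preimage_mono (hV m h)) (fun w n => hVγ (g i w) n) a ha) ha

theorem ThinSelection.s1GammaGamma [TopologicalSpace Z] (hZ : ThinSelection Z) :
    S1GammaGamma Z := by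
  intro 𝒰 h𝒰
  let u : (n : ℕ) → ℕ ↪ 𝒰 n := fun n => (h𝒰 n).2.1.natEmbedding
  have hu : ∀ z n, ∀ᶠ m in atTop, z ∈ (u n m : Set Z) := by
    intro z n
    rw [← Nat.cofinite_eq_atTop, eventually_cofinite]
    refine Finite.of_finite_image (((h𝒰 n).2.2 z).subset ?_)
      (f := fun m => (u n m : Set Z)) (Subtype.val_injective.comp (u n).injective).injOn
    rintro _ ⟨m, hm, rfl⟩
    exact ⟨(u n m).2, hm⟩
  -- Intersecting the first rows makes the double sequence decreasing; the element of `c` at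
  -- position `n` then selects from the `n`-th cover.
  obtain ⟨c, -, hc, hgood⟩ := hZ (fun n m => ⋂ i ∈ Iic n, (u i m : Set Z))
    (fun n m => (finite_Iic n).isOpen_biInter fun i _ => (h𝒰 i).1.2 _ (u i m).2)
    (fun m _ _ h => biInter_subset_biInter_left (Iic_subset_Iic.2 h))
    (fun z n => by
      simp only [mem_iInter]
      exact (eventually_all_finite (finite_Iic n)).2 fun i _ => hu z i)
    univ infinite_univ
  have hsel : ∀ z, ∀ᶠ n in atTop, z ∈ (u n (Nat.nth (· ∈ c) n) : Set Z) := by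
    intro z
    have hmono := Nat.nth_strictMono (p := (· ∈ c)) hc
    filter_upwards [hmono.tendsto_atTop.eventually (hgood z 0)] with n hn
    have hn := hn (Nat.nth_mem_of_infinite hc n)
    rw [mem_iInter₂] at hn
    refine hn n ?_
    have hle : ((Nat.nth (· ∈ c)) '' Iio n).ncard ≤
        (c ∩ Iio (Nat.nth (· ∈ c) n)).ncard := by
      refine ncard_le_ncard ?_ ((finite_Iio _).inter_of_right c)
      rintro _ ⟨i, hi, rfl⟩
      exact ⟨Nat.nth_mem_of_infinite hc i, hmono hi⟩
    rw [ncard_image_of_injective _ hmono.injective] at hle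
    simpa [ncard_eq_toFinset_card'] using hle
  refine ⟨fun n => u n (Nat.nth (· ∈ c) n), fun n => (u n _).2, ⟨⟨⟨?_, ?_⟩, ?_⟩, ?_, ?_⟩⟩
  · rintro _ ⟨n, rfl⟩
    exact (h𝒰 n).1.1.1 _ (u n _).2
  · refine eq_univ_of_forall fun z => ?_
    obtain ⟨n, hn⟩ := (hsel z).exists
    exact ⟨_, ⟨n, rfl⟩, hn⟩
  · rintro _ ⟨n, rfl⟩
    exact (h𝒰 n).1.2 _ (u n _).2
  -- With finite range one set recurs infinitely often, hence contains every point, although members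
  -- of covers are proper.
  · intro hfin
    have := hfin.to_subtype
    obtain ⟨⟨_, n, rfl⟩, hinf⟩ := Finite.exists_infinite_fiber
      (rangeFactorization fun n => (u n (Nat.nth (· ∈ c) n) : Set Z))
    refine (h𝒰 n).1.1.1 _ (u n (Nat.nth (· ∈ c) n)).2 (eq_univ_of_forall fun z => ?_)
    obtain ⟨k, hk, hzk⟩ := ((Nat.frequently_atTop_iff_infinite.2
      (infinite_coe_iff.1 hinf)).and_eventually (hsel z)).exists
    have hk : (u k (Nat.nth (· ∈ c) k) : Set Z) = u n (Nat.nth (· ∈ c) n) :=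
      congrArg Subtype.val hk
    rwa [← hk]
  · intro z
    have h := hsel z
    rw [← Nat.cofinite_eq_atTop, eventually_cofinite] at h
    refine (h.image fun n => (u n (Nat.nth (· ∈ c) n) : Set Z)).subset ?_
    rintro _ ⟨⟨n, rfl⟩, hz⟩
    exact ⟨n, hz, rfl⟩

end Thinning

/-! ### From the γ-property to S₁(Ω,Γ) in finite powers. -/

section Gamma

/-- A finite set whose power lies in an open set has a neighbourhood whose power lies there too. -/
theorem exists_isOpen_pi_subset {ι Y : Type*} [Finite ι] [TopologicalSpace Y] {H : Set Y}
    (hH : H.Finite) {U : Set (ι → Y)} (hU : IsOpen U) (hHU : univ.pi (fun _ => H) ⊆ U) :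
    ∃ W, IsOpen W ∧ H ⊆ W ∧ univ.pi (fun _ => W) ⊆ U := by
  have hfin : (univ.pi fun _ : ι => H).Finite := Set.Finite.pi fun _ => hH
  choose! u hu huU using fun t (ht : t ∈ univ.pi fun _ : ι => H) => isOpen_pi_iff'.1 hU t (hHU ht)
  let N : Y → Set Y := fun h => ⋂ t ∈ univ.pi (fun _ : ι => H), ⋂ i : ι, ⋂ _ : t i = h, u t i
  have hN : ∀ h, IsOpen (N h) := fun h => hfin.isOpen_biInter fun t ht =>
    isOpen_iInter_of_finite fun i => isOpen_iInter_of_finite fun _ => (hu t ht i).1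
  refine ⟨⋃ h ∈ H, N h, isOpen_biUnion fun h _ => hN h, ?_, ?_⟩
  · intro h hh
    refine mem_biUnion hh ?_
    simp only [N, mem_iInter]
    rintro t ht i rfl
    exact (hu t ht i).2
  · intro y hy
    have hy' : ∀ i, ∃ h ∈ H, y i ∈ N h := fun i => by simpa using hy i (mem_univ i)
    choose t htH hyt using hy'
    have ht : t ∈ univ.pi fun _ : ι => H := fun i _ => htH i
    refine huU t ht fun i _ => ?_
    have := hyt i
    simp only [N, mem_iInter] at this
    exact this t ht i rfl

/-- The selection principle `S₁(Ω, Γ)`, with the selected sets indexed and not required to be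
proper. -/
def OmegaSelection (Y : Type*) [TopologicalSpace Y] : Prop :=
  ∀ 𝒰 : ℕ → Set (Set Y), (∀ n, ∀ U ∈ 𝒰 n, IsOpen U) →
    (∀ n, ∀ F : Set Y, F.Finite → ∃ U ∈ 𝒰 n, F ⊆ U) →
      ∃ U : ℕ → Set Y, (∀ n, U n ∈ 𝒰 n) ∧ ∀ y, ∀ᶠ n in atTop, y ∈ U n

theorem GammaProperty.omegaSelection_pi {ι Y : Type*} [Finite ι] [TopologicalSpace Y] [T1Space Y]
    (hY : GammaProperty Y) : OmegaSelection (ι → Y) := by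
  intro 𝒰 hopen hω
  rcases finite_or_infinite Y with hYf | hYi
  · choose U hU hsub using fun n => hω n univ finite_univ
    exact ⟨U, hU, fun y => Eventually.of_forall fun n => hsub n (mem_univ y)⟩
  let x : ℕ ↪ Y := Infinite.natEmbedding Y
  let 𝒱 : ℕ → Set (Set Y) := fun n =>
    {W | IsOpen W ∧ ∀ i ≤ n, ∃ U ∈ 𝒰 i, univ.pi (fun _ => W) ⊆ U}
  -- Removing `x n` makes members proper and marks their level: in a γ-cover only finitely many
  -- members omit `x n`, so levels tend to infinity.
  let 𝒲 : Set (Set Y) := {G | ∃ n, ∃ W ∈ 𝒱 n, G = W \ {x n}}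
  have hcov : ∀ F : Set Y, F.Finite → ∃ G ∈ 𝒲, F ⊆ G := by
    intro F hF
    obtain ⟨n, hn⟩ : ∃ n, x n ∉ F := by
      by_contra! h
      exact infinite_range_of_injective x.injective (hF.subset (range_subset_iff.2 h))
    choose U hU hsub using fun i => hω i (univ.pi fun _ : ι => F) (Set.Finite.pi fun _ => hF)
    choose W hWo hFW hW using fun i => exists_isOpen_pi_subset hF (hopen i _ (hU i)) (hsub i)
    refine ⟨(⋂ i ∈ Iic n, W i) \ {x n}, ⟨n, _, ⟨(finite_Iic n).isOpen_biInter fun i _ => hWo i,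
      fun i hi => ⟨U i, hU i, Subset.trans (pi_mono fun _ _ => biInter_subset_of_mem hi) (hW i)⟩⟩,
      rfl⟩, ?_⟩
    exact fun y hy => ⟨mem_iInter₂.2 fun i _ => hFW i hy, fun h => hn (h ▸ hy)⟩
  have hΩ : 𝒲 ∈ Om Y := by
    refine ⟨⟨⟨?_, eq_univ_of_forall fun y => ?_⟩, ?_⟩, hcov⟩
    · rintro _ ⟨n, W, -, rfl⟩ h
      have : x n ∈ W \ {x n} := h ▸ mem_univ _
      exact this.2 rfl
    · obtain ⟨G, hG, hy⟩ := hcov {y} (finite_singleton y)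
      exact ⟨G, hG, hy rfl⟩
    · rintro _ ⟨n, W, hW, rfl⟩
      exact hW.1.sdiff isClosed_singleton
  obtain ⟨𝒢, h𝒢, ⟨-, hinf, hpt⟩⟩ := hY 𝒲 hΩ
  have h𝒢' : ∀ G ∈ 𝒢, ∃ n, ∃ W ∈ 𝒱 n, G = W \ {x n} := fun G hG => h𝒢 hG
  choose! r W hW hGW using h𝒢'
  have hlarge : ∀ n, (𝒢 ∩ {G | n ≤ r G}).Infinite := by
    intro n hfin
    refine hinf ((hfin.union ((finite_Iio n).biUnion fun i _ => hpt (x i))).subset ?_)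
    intro G hG
    by_cases h : n ≤ r G
    · exact Or.inl ⟨hG, h⟩
    · refine Or.inr (mem_biUnion (not_le.1 h : r G ∈ Iio n) ⟨hG, ?_⟩)
      intro hx
      exact ((hGW G hG).subset hx).2 rfl
  obtain ⟨G, hG⟩ : ∃ G : ℕ → Set Y, ∀ n, (G n ∈ 𝒢 ∧ n ≤ r (G n)) ∧ ∀ i < n, G i ≠ G n := by
    obtain ⟨G, hG⟩ := exists_seq_of_forall_finset_exists
      (fun p : ℕ × Set Y => p.2 ∈ 𝒢 ∧ p.1 ≤ r p.2) (fun p q => p.1 < q.1 ∧ p.2 ≠ q.2) (by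
        intro s _
        obtain ⟨n, hn⟩ := (s.image Prod.fst).bddAbove
        obtain ⟨G, hG, hGs⟩ := (hlarge (n + 1)).exists_notMem_finset (s.image Prod.snd)
        refine ⟨(n + 1, G), hG, fun p hp => ⟨?_, fun h => hGs ?_⟩⟩
        · exact Nat.lt_succ_of_le (hn (Finset.mem_image_of_mem _ hp))
        · exact Finset.mem_image.2 ⟨p, hp, h⟩)
    have hmono : StrictMono fun n => (G n).1 := fun m n h => (hG.2 m n h).1
    exact ⟨fun n => (G n).2, fun n => ⟨⟨(hG.1 n).1, (hmono.id_le n).trans (hG.1 n).2⟩,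
      fun i hi => (hG.2 i n hi).2⟩⟩
  have hinj : Function.Injective G := fun i j h => by
    rcases lt_trichotomy i j with hij | hij | hij
    · exact absurd h ((hG j).2 i hij)
    · exact hij
    · exact absurd h.symm ((hG i).2 j hij)
  choose U hU hsub using fun n => (hW _ (hG n).1.1).2 n (hG n).1.2
  refine ⟨U, hU, fun y => ?_⟩
  have hev : ∀ z, ∀ᶠ n in atTop, z ∈ G n := by
    intro z
    rw [← Nat.cofinite_eq_atTop, eventually_cofinite]
    refine Finite.of_finite_image ((hpt z).subset ?_) hinj.injOn
    rintro _ ⟨n, hn, rfl⟩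
    exact ⟨(hG n).1.1, hn⟩
  filter_upwards [eventually_all.2 fun i => hev (y i)] with n hn
  refine hsub n fun i _ => ?_
  have := hn i
  rw [hGW _ (hG n).1.1] at this
  exact this.1

end Gamma

/-! ### Good columns for generalized tower sets. -/

section Tower

variable {ι : Type*} {Y : Type*} [TopologicalSpace Y] {T : Set (ℕ → Bool)}

/-- Membership in a neighbourhood depends on finitely many digits. -/
theorem exists_forall_agree_mem [Finite ι] {x : ι → T} {A : Set (ι → T)} (hA : A ∈ 𝓝 x) :
    ∃ l, ∀ x' : ι → T, (∀ i, ∀ n < l, (x' i : ℕ → Bool) n = (x i : ℕ → Bool) n) → x' ∈ A := by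
  rw [(IsInducing.piMap fun _ : ι => IsInducing.subtypeVal).nhds_eq_comap, mem_comap] at hA
  obtain ⟨B, hB, hBA⟩ := hA
  obtain ⟨B', hB', hBo, hxB⟩ := mem_nhds_iff.1 hB
  obtain ⟨u, hu, huB⟩ := isOpen_pi_iff'.1 hBo _ hxB
  choose I v hv hvu using fun i => isOpen_pi_iff.1 (hu i).1 _ (hu i).2
  choose M hM using fun i => (I i).bddAbove
  obtain ⟨L, hL⟩ := (finite_range M).bddAbove
  refine ⟨L + 1, fun x' hx' => hBA (hB' (huB fun i _ => hvu i fun n hn => ?_))⟩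
  have hnL : n < L + 1 := Nat.lt_succ_of_le ((hM i hn).trans (hL ⟨i, rfl⟩))
  have := (hv i n hn).2
  simp only [Pi.map_apply] at this ⊢
  rwa [hx' i n hnL]

/-- The tuple of finite sets with prescribed digits below `N`. -/
def digitPoint (hT : ∀ z : ℕ → Bool, {n | z n = true}.Finite → z ∈ T) (N : ℕ)
    (s : ι → Fin N → Bool) (i : ι) : T :=
  ⟨fun n => if h : n < N then s i ⟨n, h⟩ else false, hT _ ((finite_Iio N).subset fun n hn => by
    by_contra h
    have h' : ¬ n < N := h
    simp [h'] at hn)⟩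

/-- The points of the slices of `U` at all tuples avoiding `[N, l)`, locally uniformly. -/
def robustSlice (U : Set ((ι → T) × Y)) (N l : ℕ) : Set Y :=
  {y | ∃ W, IsOpen W ∧ y ∈ W ∧ ∀ x : ι → T,
    (∀ i, ∀ n ∈ Ico N l, (x i : ℕ → Bool) n = false) → ∀ y' ∈ W, (x, y') ∈ U}

theorem isOpen_robustSlice (U : Set ((ι → T) × Y)) (N l : ℕ) : IsOpen (robustSlice U N l) :=
  isOpen_iff_forall_mem_open.2 fun _ ⟨W, hW, hy, h⟩ => ⟨W, fun _ hy' => ⟨W, hW, hy', h⟩, hW, hy⟩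

theorem robustSlice_mono (U : Set ((ι → T) × Y)) (N : ℕ) : Monotone (robustSlice U N) :=
  fun _ _ hl _ ⟨W, hW, hy, h⟩ =>
    ⟨W, hW, hy, fun x hx => h x fun i n hn => hx i n ⟨hn.1, hn.2.trans_le hl⟩⟩

/-- There are finitely many digit patterns below `N`. A tuple vanishing on `[N, L)` agrees below `L`
with the digit point of its own pattern, hence lies in that point's neighbourhood. -/
theorem exists_mem_robustSlice [Finite ι]
    (hT : ∀ z : ℕ → Bool, {n | z n = true}.Finite → z ∈ T)
    {U : Set ((ι → T) × Y)} (hU : IsOpen U) {N : ℕ} {y : Y}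
    (hy : ∀ s : ι → Fin N → Bool, (digitPoint hT N s, y) ∈ U) : ∃ l, y ∈ robustSlice U N l := by
  choose A hA B hB hAB using fun s => mem_nhds_prod_iff.1 (hU.mem_nhds (hy s))
  choose l hl using fun s => exists_forall_agree_mem (hA s)
  obtain ⟨L, hL⟩ := (finite_range l).bddAbove
  refine ⟨L, ⋂ s, interior (B s), isOpen_iInter_of_finite fun s => isOpen_interior,
    mem_iInter.2 fun s => mem_interior_iff_mem_nhds.2 (hB s), fun x hx y' hy' => ?_⟩
  let s : ι → Fin N → Bool := fun i j => (x i : ℕ → Bool) j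
  refine hAB s ⟨hl s x fun i n hn => ?_, interior_subset (mem_iInter.1 hy' s)⟩
  by_cases h : n < N
  · simp [digitPoint, h, s]
  · simp only [digitPoint, h, dite_false]
    exact hx i n ⟨not_lt.1 h, hn.trans_le (hL ⟨s, rfl⟩)⟩

theorem enum_range {A : ℕ → ℕ} (hA : StrictMono A) (n : ℕ) : enum (range A) n = A n := by
  have hinf : (range A).Infinite := infinite_range_of_injective hA.injective
  have := Nat.nth_comp_of_strictMono (p := (· ∈ range A)) (n := n) hA (fun k hk => hk)
    (fun hf => absurd hf hinf)
  rw [enum, ← this, Nat.nth_of_forall fun k _ => mem_range_self k]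

variable {X : Set (Set ℕ)}

theorem mem_towerSet_of_finite (z : ℕ → Bool) (hz : {n | z n = true}.Finite) : z ∈ towerSet X :=
  Or.inr hz

/-- Outside fewer than `𝔭` exceptional members of the tower, a double sequence with
point-cofinite rows has a good set of columns. -/
theorem IsGeneralizedTower.exists_good [Finite ι] {κ : Cardinal.{0}} (hX : IsGeneralizedTower κ X)
    (hY : OmegaSelection Y) {V : ℕ → ℕ → Set ((ι → towerSet X) × Y)}
    (hVo : ∀ n m, IsOpen (V n m)) (hV : ∀ m, Antitone fun n => V n m)
    (hVγ : ∀ z n, ∀ᶠ m in atTop, z ∈ V n m) {a : Set ℕ} (ha : a.Infinite) :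
    ∃ S ⊆ X, #S < κ ∧ ∃ c ⊆ a, c.Infinite ∧ ∀ x y,
      (∀ i, {n | (x i : ℕ → Bool) n = true} ∉ S) → IsGoodAt V c (x, y) := by
  obtain ⟨U, hU, hUγ⟩ := hY
    (fun N => {G | ∃ m ∈ a, ∃ l, N ≤ m ∧ N < l ∧ G = robustSlice (V N m) N l})
    (by
      rintro N _ ⟨m, -, l, -, -, rfl⟩
      exact isOpen_robustSlice _ _ _)
    (by
      intro N F hF
      have hev : ∀ᶠ m in atTop, N ≤ m ∧ ∀ y ∈ F, ∀ s : ι → Fin N → Bool,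
          (digitPoint mem_towerSet_of_finite N s, y) ∈ V N m :=
        (eventually_ge_atTop N).and ((eventually_all_finite hF).2 fun y _ =>
          eventually_all.2 fun s => hVγ _ N)
      obtain ⟨m, hma, hNm, hm⟩ := ((Nat.frequently_atTop_iff_infinite.2 ha).and_eventually hev).exists
      choose! l hl using fun y (hy : y ∈ F) => exists_mem_robustSlice _ (hVo N m) (hm y hy)
      obtain ⟨L, hL⟩ := (hF.image l).bddAbove
      exact ⟨_, ⟨m, hma, max L (N + 1), hNm, by simp, rfl⟩, fun y hy =>
        robustSlice_mono _ _ ((hL ⟨y, hy, rfl⟩).trans (le_max_left _ _)) (hl y hy)⟩)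
  choose m hma l hNm hNl hUeq using hU
  -- Iterating `l` makes `[A j, A (j + 1))` exactly the interval to be avoided for the slice
  -- selected at `N = A j`.
  let A : ℕ → ℕ := fun j => l^[j] 0
  have hAs : ∀ j, A (j + 1) = l (A j) := fun j => Function.iterate_succ_apply' l j 0
  have hA : StrictMono A := strictMono_nat_of_lt_succ fun j => by
    rw [hAs]
    exact hNl _
  obtain ⟨b, hb, S, hSX, hS, hfin⟩ := hX.2.2 (range A) (infinite_range_of_injective hA.injective)
  simp only [enum_range hA] at hfin
  have hβ := Nat.nth_strictMono (p := (· ∈ b)) hb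
  let f : ℕ → ℕ := fun i => m (A (Nat.nth (· ∈ b) i))
  have hAβ : ∀ i, i ≤ A (Nat.nth (· ∈ b) i) := fun i => (hA.comp hβ).id_le i
  obtain ⟨c, hcf, hc, hgood⟩ := exists_good_of_selection hV (f := f)
    fun i => (hAβ i).trans (hNm _)
  refine ⟨S, hSX, hS, c, hcf.trans ?_, hc, fun x y hx => hgood _ ?_⟩
  · rintro _ ⟨i, rfl⟩
    exact hma _
  have havoid : ∀ i, ∀ᶠ j in atTop, j ∈ b →
      ∀ n ∈ Ico (A j) (A (j + 1)), (x i : ℕ → Bool) n = false := by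
    intro i
    have hfi : ({n | (x i : ℕ → Bool) n = true} ∩
        ⋃ n ∈ b, Ico (A n) (A (n + 1))).Finite := by
      rcases (x i).2 with h | h
      · exact hfin _ ⟨h, hx i⟩
      · exact Finite.inter_of_left h _
    obtain ⟨M, hM⟩ := hfi.bddAbove
    filter_upwards [eventually_gt_atTop M] with j hj hjb n hn
    by_contra hxn
    have := hM ⟨by simpa using hxn, mem_biUnion hjb hn⟩
    exact absurd (this.trans_lt (hj.trans_le (hA.id_le j))) (not_lt.2 hn.1)
  have hev : ∀ᶠ j in atTop, (∀ i, j ∈ b →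
      ∀ n ∈ Ico (A j) (A (j + 1)), (x i : ℕ → Bool) n = false) ∧ y ∈ U (A j) :=
    (eventually_all.2 havoid).and (hA.tendsto_atTop.eventually (hUγ y))
  filter_upwards [hβ.tendsto_atTop.eventually hev] with i hi
  obtain ⟨h1, h2⟩ := hi
  rw [hUeq] at h2
  obtain ⟨W, -, hyW, hW⟩ := h2
  refine hV _ (hAβ i) (hW x (fun k n hn => h1 k (Nat.nth_mem_of_infinite hb i) n ?_) y hyW)
  rwa [hAs]

theorem IsGeneralizedTower.thinSelection_prod (hX : IsGeneralizedTower pCard X)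
    (hY : OmegaSelection Y) (k : ℕ) : ThinSelection ((Fin k → towerSet X) × Y) := by
  classical
  induction k with
  | zero =>
    intro V hVo hV hVγ a ha
    obtain ⟨S, -, -, c, hca, hc, hgood⟩ := hX.exists_good hY hVo hV hVγ ha
    exact ⟨c, hca, hc, fun z => hgood z.1 z.2 fun i => i.elim0⟩
  | succ k ih =>
    intro V hVo hV hVγ a ha
    obtain ⟨S, hSX, hS, c, hca, hc, hgood⟩ := hX.exists_good hY hVo hV hVγ ha
    have hp : ℵ₀ ≤ pCard := aleph0_le_pCard (ne_bot_of_gt hS)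
    have hcard : #(Fin (k + 1) × S) < pCard := by
      rw [Cardinal.mk_prod, Cardinal.lift_id, Cardinal.lift_id]
      exact Cardinal.mul_lt_of_lt hp ((Cardinal.lt_aleph0_of_finite _).trans_le hp) hS
    let pt : S → towerSet X := fun s => ⟨fun n => decide (n ∈ s.1), Or.inl (by simpa using hSX s.2)⟩
    -- Each pair of a coordinate and an exceptional member fixes that coordinate, leaving a copy of
    -- the product with one factor fewer.
    obtain ⟨d, hdc, hd, hgood'⟩ := ih.exists_good_of_lt_pCard hcard
      (fun (p : Fin (k + 1) × S) w => (p.1.insertNth (pt p.2) w.1, w.2))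
      (fun p => (Continuous.finInsertNth (A := fun _ => towerSet X) p.1
        continuous_const continuous_fst).prodMk continuous_snd)
      hVo hV hVγ hc
    refine ⟨d, hdc.trans hca, hd, fun ⟨x, y⟩ => ?_⟩
    by_cases hx : ∀ i, {n | (x i : ℕ → Bool) n = true} ∉ S
    · exact (hgood x y hx).of_almostSubset hV (AlmostSubset.of_subset hdc)
    · push Not at hx
      obtain ⟨i, hi⟩ := hx
      have hpt : pt ⟨_, hi⟩ = x i := by
        ext n
        simp [pt]
      have := hgood' (i, ⟨_, hi⟩) (i.removeNth x, y)
      rwa [hpt, Fin.insertNth_self_removeNth] at this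

end Tower

theorem ThinSelection.of_surjective {Z W : Type*} [TopologicalSpace Z] [TopologicalSpace W]
    (hW : ThinSelection W) {g : W → Z} (hg : Continuous g) (hs : Function.Surjective g) :
    ThinSelection Z := by
  intro V hVo hV hVγ a ha
  obtain ⟨c, hca, hc, hgood⟩ := hW (fun n m => g ⁻¹' V n m) (fun n m => (hVo n m).preimage hg)
    (fun m _ _ h => preimage_mono (hV m h)) (fun w n => hVγ (g w) n) a ha
  exact ⟨c, hca, hc, hs.forall.2 hgood⟩

end GenTower

theorem mainTheorem6 (X : Set (Set ℕ)) (hX : GenTower.IsGeneralizedTower GenTower.pCard X)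
    (Y : Type*) [TopologicalSpace Y] (hY : GenTower.IsSetOfReals Y)
    (hYγ : GenTower.GammaProperty Y) (k : ℕ) :
    GenTower.S1GammaGamma (Fin k → ↥(GenTower.towerSet X) × Y) := by
  obtain ⟨e, he⟩ := hY
  have : T1Space Y := he.t1Space
  have hT := hX.thinSelection_prod (hYγ.omegaSelection_pi (ι := Fin k)) k
  refine (hT.of_surjective (g := fun w i => (w.1 i, w.2 i)) (by fun_prop) fun z => ?_).s1GammaGamma
  exact ⟨(fun i => (z i).1, fun i => (z i).2), rfl⟩
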